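/- Let $k$ be an infinite field with $\operatorname{char} k\neq 2$. Let $a,b,c,d,\beta\in k$, where $a$ is not a square in $k$, $b=\beta^2$ with $\beta\neq 0$, and at least one of $c,d$ is non-zero. Let $L_0=k(t_1,t_2,t_3,t_4)$ be a field extension of $k$ of transcendence degree $2$ whose generators satisfy $$t_1^2-at_2^2=b,\qquad t_3^2-at_4^2=2ct_1+d .$$ For a field $K$ of characteristic different from $2$ and non-zero $u,v\in K$, let $(u,v)_{2,K}$ denote the class in the Brauer group $\operatorname{Br}(K)$ of the quaternion algebra over $K$ with basis $1,i,j,ij$ and relations $i^2=u$, $j^2=v$, $ij=-ji$. A field extension $L$ of $k$ is called $k$-rational if it is $k$-isomorphic to a rational function field $k(x_1,\dots,x_n)$ for some integer $n\ge 0$, stably $k$-rational if the rational function field $L(y_1,\dots,y_m)$ is $k$-rational for some integer $m\ge 0$, and $k$-unirational if it is $k$-isomorphic to a subfield of some $k$-rational field. Then the following statements are equivalent: (i) $L_0$ is $k$-rational; (ii) $L_0$ is stably $k$-rational; (iii) $L_0$ is $k$-unirational; (iv) either $-2c\beta+d\neq 0$ and $(a,-2c\beta+d)_{2,k'}=0$,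 where $k'=k(\sqrt{d^2-4bc^2})$, or $-2c\beta+d=0$ and $(a,2d)_{2,k}=0$. -/

import Mathlib

open scoped Quaternion

universe u v w

/-- `L` is `k`-rational: it is `k`-isomorphic to the quotient field of a polynomial ring over `k`
in finitely many variables. -/
def IsRationalExtension (k : Type u) (L : Type v) [Field k] [Field L] [Algebra k L] : Prop :=
  ∃ n : ℕ, Nonempty (L ≃ₐ[k] FractionRing (MvPolynomial (Fin n) k))

/-- `L` is stably `k`-rational: some rational function field `L(y₁, …, yₘ)` over `L` is
`k`-rational. -/
def IsStablyRationalExtension (k : Type u) (L : Type v) [Field k] [Field L] [Algebra k L] : Prop :=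
  ∃ m : ℕ, IsRationalExtension k (FractionRing (MvPolynomial (Fin m) L))

/-- `L` is `k`-unirational: it is `k`-isomorphic to a subfield of a `k`-rational field. -/
def IsUnirationalExtension (k : Type u) (L : Type v) [Field k] [Field L] [Algebra k L] : Prop :=
  ∃ n : ℕ, Nonempty (L →ₐ[k] FractionRing (MvPolynomial (Fin n) k))

namespace QuaternionSymbol

variable {K : Type u} [Field K]

theorem isCentral (a b : K) (h2 : (2 : K) ≠ 0) (ha : a ≠ 0) :
    Algebra.IsCentral K ℍ[K,a,b] := by
  refine ⟨fun q hq => ?_⟩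
  rw [Subalgebra.mem_center_iff] at hq
  have hi := hq ⟨0, 1, 0, 0⟩
  have hj := hq ⟨0, 0, 1, 0⟩
  obtain ⟨x, y, z, t⟩ := q
  simp only [QuaternionAlgebra.mk_mul_mk, QuaternionAlgebra.mk.injEq] at hi hj
  have hy : y = 0 := by
    have h : 2 * y = 0 := by linear_combination -hj.2.2.2
    simpa [h2] using h
  have hz : z = 0 := by
    have h : 2 * z = 0 := by linear_combination hi.2.2.2
    simpa [h2] using h
  have ht : t = 0 := by
    have h : 2 * a * t = 0 := by linear_combination hi.2.2.1
    simpa [h2, ha] using h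
  subst hy hz ht
  rw [Algebra.mem_bot]
  exact ⟨x, rfl⟩

theorem isSimpleRing (a b : K) (h2 : (2 : K) ≠ 0) (ha : a ≠ 0) (hb : b ≠ 0) :
    IsSimpleRing ℍ[K,a,b] := by
  refine IsSimpleRing.of_eq_bot_or_eq_top fun I => ?_
  by_cases hI : I = ⊥
  · exact Or.inl hI
  right
  have key : ∀ p q : ℍ[K,a,b], p ∈ I → q * p = 1 → I = ⊤ := fun p q hp hpq => by
    rw [← TwoSidedIdeal.one_mem_iff, ← hpq]
    exact I.mul_mem_left _ _ hp
  obtain ⟨q, hq, hq0⟩ : ∃ q ∈ I, q ≠ 0 := by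
    by_contra! h
    exact hI (le_bot_iff.mp fun q hq => (TwoSidedIdeal.mem_bot _).mpr (h q hq))
  obtain ⟨x, y, z, t⟩ := q
  have conj : ∀ p r s : ℍ[K,a,b], p ∈ I → r * p * s ∈ I := fun p r s hp =>
    I.mul_mem_right _ _ (I.mul_mem_left _ _ hp)
  have h4 : (4 : K) ≠ 0 := by
    have : (4 : K) = 2 * 2 := by norm_num
    rw [this]; exact mul_ne_zero h2 h2
  -- averaging over conjugation by `i` and by `j` isolates each coordinate
  have hi : ∀ p : ℍ[K,a,b], p ∈ I →
      (⟨2 * p.re, 2 * p.imI, 0, 0⟩ : ℍ[K,a,b]) ∈ I ∧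
      (⟨0, 0, 2 * p.imJ, 2 * p.imK⟩ : ℍ[K,a,b]) ∈ I := fun p hp => by
    have h := conj p ⟨0, 1, 0, 0⟩ ⟨0, a⁻¹, 0, 0⟩ hp
    refine ⟨?_, ?_⟩
    · convert I.add_mem hp h using 1
      ext <;> simp <;> field_simp <;> ring
    · convert I.sub_mem hp h using 1
      ext <;> simp <;> field_simp <;> ring
  have hj : ∀ p : ℍ[K,a,b], p ∈ I →
      (⟨2 * p.re, 0, 2 * p.imJ, 0⟩ : ℍ[K,a,b]) ∈ I ∧
      (⟨0, 2 * p.imI, 0, 2 * p.imK⟩ : ℍ[K,a,b]) ∈ I := fun p hp => by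
    have h := conj p ⟨0, 0, 1, 0⟩ ⟨0, 0, b⁻¹, 0⟩ hp
    refine ⟨?_, ?_⟩
    · convert I.add_mem hp h using 1
      ext <;> simp <;> field_simp <;> ring
    · convert I.sub_mem hp h using 1
      ext <;> simp <;> field_simp <;> ring
  by_cases hx : x = 0
  · by_cases hy : y = 0
    · by_cases hz : z = 0
      · by_cases ht : t = 0
        · subst hx hy hz ht
          exact absurd rfl hq0
        · refine key _ ⟨0, 0, 0, -(4 * t * a * b)⁻¹⟩ (hj _ (hi _ hq).2).2 ?_
          ext <;> simp <;> field_simp <;> ring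
      · refine key _ ⟨0, 0, (4 * z * b)⁻¹, 0⟩ (hj _ (hi _ hq).2).1 ?_
        ext <;> simp <;> field_simp <;> ring
    · refine key _ ⟨0, (4 * y * a)⁻¹, 0, 0⟩ (hj _ (hi _ hq).1).2 ?_
      ext <;> simp <;> field_simp <;> ring
  · refine key _ ⟨(4 * x)⁻¹, 0, 0, 0⟩ (hj _ (hi _ hq).1).1 ?_
    ext <;> simp <;> field_simp <;> ring

end QuaternionSymbol

/-- The quaternion algebra `(a, b)_{2,K}`, with `K`-basis `1, i, j, i * j` and `i² = a`, `j² = b`,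
`i * j = -(j * i)`, as a central simple algebra over the field `K` of characteristic not two. -/
def quaternionCSA {K : Type u} [Field K] (a b : K) (h2 : (2 : K) ≠ 0) (ha : a ≠ 0) (hb : b ≠ 0) :
    CSA.{u, u} K :=
  { AlgCat.of K ℍ[K,a,b] with
    isCentral := QuaternionSymbol.isCentral a b h2 ha
    isSimple := QuaternionSymbol.isSimpleRing a b h2 ha hb
    fin_dim := inferInstanceAs (Module.Finite K ℍ[K,a,b]) }

/-- The Hilbert symbol: the class of `(a, b)_{2,K}` in the Brauer group of `K`. -/
def hilbertSymbol {K : Type u} [Field K] (a b : K) (h2 : (2 : K) ≠ 0) (ha : a ≠ 0) (hb : b ≠ 0) :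
    BrauerGroup.{u, u} K :=
  Quotient.mk (Brauer.CSA_Setoid K) (quaternionCSA a b h2 ha hb)

/-- The zero element of the Brauer group of `K`: the class of `K` itself. -/
def brauerZero (K : Type u) [Field K] : BrauerGroup.{u, u} K :=
  Quotient.mk (Brauer.CSA_Setoid K)
    { AlgCat.of K K with
      isCentral := inferInstanceAs (Algebra.IsCentral K K)
      isSimple := inferInstanceAs (IsSimpleRing K)
      fin_dim := inferInstanceAs (Module.Finite K K) }

/-- `(a, b)_{2,K} = 0` in the Brauer group of `K`; the symbol is defined only for nonzero `a`, `b`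
and characteristic not two, so this includes these conditions. -/
def HilbertSymbolEqZero (K : Type u) [Field K] (a b : K) : Prop :=
  ∃ (h2 : (2 : K) ≠ 0) (ha : a ≠ 0) (hb : b ≠ 0), hilbertSymbol a b h2 ha hb = brauerZero K

/-! Write N for the norm form p² - aq², e = 2cβ + d and f = -2cβ + d. With x = t₂/(t₁ + β), the
conic N(t₁, t₂) = β² gives (2ct₁ + d)(1 - ax²) = e - afx². Since 1 - ax² is itself a norm, L₀
becomes the function field of the quadric N(y, z) = e - afx² (`exists_quadric_generators`).

Everything is compared with `HasCommonValue a e f`. A unirational L₀ gives a point of the quadric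
over a rational function field, which specializes to k because k is infinite
(`hasCommonValue_of_fractionRing`). Conversely, multiplying the equation by a common value turns it
into Y² - aZ² = U² - aefV², which splits off (Y - U)(Y + U) and so is rational
(`isRationalExtension_of_hasCommonValue`).

For f ≠ 0, a common value exists exactly when f is a norm for a over k' = k(√(ef)); for f = 0, when
e = 2d is a norm over k. `hilbertSymbolEqZero_iff` translates norms into vanishing symbols. -/

/-- `b` is a norm from `K(√a)`. -/
def IsBinaryNorm {K : Type*} [Field K] (a b : K) : Prop := ∃ p q : K, b = p ^ 2 - a * q ^ 2

/-! ### Norms from K(√a) -/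

namespace IsBinaryNorm

variable {K : Type*} [Field K] {a : K}

theorem of_isSquare (h2 : (2 : K) ≠ 0) (ha0 : a ≠ 0) (ha : IsSquare a) (b : K) :
    IsBinaryNorm a b := by
  obtain ⟨r, rfl⟩ := ha
  have hr : r ≠ 0 := fun h => ha0 (by simp [h])
  -- Solves p - rq = 1, p + rq = b.
  exact ⟨(b + 1) / 2, (b - 1) / (2 * r), by field_simp; ring⟩

/-- The norm is multiplicative: the witnesses are the coordinates of (r + s√a)/(p + q√a). -/
theorem of_mul_eq {b : K} {p q r s : K} (h0 : p ^ 2 - a * q ^ 2 ≠ 0)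
    (h : b * (p ^ 2 - a * q ^ 2) = r ^ 2 - a * s ^ 2) : IsBinaryNorm a b :=
  ⟨(r * p - a * s * q) / (p ^ 2 - a * q ^ 2), (s * p - r * q) / (p ^ 2 - a * q ^ 2), by
    field_simp
    linear_combination (p ^ 2 - a * q ^ 2) * h⟩

end IsBinaryNorm

theorem sq_sub_mul_sq_ne_zero {K : Type*} [Field K] {a : K} (ha : ¬ IsSquare a) {p q : K}
    (h : p ≠ 0 ∨ q ≠ 0) : p ^ 2 - a * q ^ 2 ≠ 0 := by
  intro h0
  by_cases hq : q = 0
  · subst hq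
    simp_all
  · exact ha ⟨p / q, by field_simp; linear_combination -h0⟩

/-! ### Split quaternion algebras and norms -/

namespace QuaternionSymbol

variable {K : Type u} [Field K]

/-- An idempotent of non-zero reduced norm is invertible, hence 1. So the reduced norm of `h`
vanishes, which exhibits b as a quotient of two norms. -/
theorem isBinaryNorm_of_isIdempotentElem {a b : K} (h2 : (2 : K) ≠ 0) (ha : a ≠ 0)
    {h : ℍ[K,a,b]} (hh : h * h = h) (h0 : h ≠ 0) (h1 : h ≠ 1) : IsBinaryNorm a b := by
  by_cases hsq : IsSquare a
  · exact .of_isSquare h2 ha hsq b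
  obtain ⟨x, y, z, t⟩ := h
  have hN : x ^ 2 - a * y ^ 2 - b * (z ^ 2 - a * t ^ 2) = 0 := by
    by_contra hN
    apply h1
    have key : (⟨x, -y, -z, -t⟩ : ℍ[K,a,b]) * (⟨x, y, z, t⟩ * ⟨x, y, z, t⟩) =
      ⟨x, -y, -z, -t⟩ * ⟨x, y, z, t⟩ := by rw [hh]
    rw [← mul_assoc] at key
    have hs : (⟨x, -y, -z, -t⟩ : ℍ[K,a,b]) * ⟨x, y, z, t⟩ =
        (x ^ 2 - a * y ^ 2 - b * (z ^ 2 - a * t ^ 2)) • (1 : ℍ[K,a,b]) := by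
      ext <;> simp <;> ring
    rw [hs, smul_mul_assoc, one_mul] at key
    have := congrArg (fun w => (x ^ 2 - a * y ^ 2 - b * (z ^ 2 - a * t ^ 2))⁻¹ • w) key
    simpa only [smul_smul, inv_mul_cancel₀ hN, one_smul] using this
  by_cases hzt : z ≠ 0 ∨ t ≠ 0
  · exact .of_mul_eq (r := x) (s := y) (sq_sub_mul_sq_ne_zero hsq hzt) (by linear_combination -hN)
  · push Not at hzt
    obtain ⟨rfl, rfl⟩ := hzt
    by_cases hxy : x ≠ 0 ∨ y ≠ 0
    · exact absurd (by linear_combination hN) (sq_sub_mul_sq_ne_zero hsq hxy)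
    · push Not at hxy
      obtain ⟨rfl, rfl⟩ := hxy
      exact absurd rfl h0

open Matrix in
-- The quaternion algebra is a corner of the matrix algebra over K, cut out by an idempotent `p`. A
-- rank-one idempotent below `p` pulls back to a nontrivial idempotent quaternion.
theorem isBinaryNorm_of_matrix_algEquiv {a b : K} (h2 : (2 : K) ≠ 0) (ha : a ≠ 0) {n m : ℕ}
    (hn : n ≠ 0) (e : Matrix (Fin n) (Fin n) ℍ[K,a,b] ≃ₐ[K] Matrix (Fin m) (Fin m) K) :
    IsBinaryNorm a b := by
  let o : Fin n := ⟨0, Nat.pos_of_ne_zero hn⟩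
  let E : ℍ[K,a,b] → Matrix (Fin n) (Fin n) ℍ[K,a,b] := fun h => single o o h
  have hEmul : ∀ g h, E g * E h = E (g * h) := fun g h => by simp [E]
  have hEsmul : ∀ (r : K) h, E (r • h) = r • E h := fun r h => by simp [E, smul_single]
  have hEinj : Function.Injective E := fun g h hgh => by
    simpa [E] using congrFun (congrFun hgh o) o
  have hE : ∀ N, E 1 * N * E 1 = E (N o o) := fun N => by
    simp [E, single_mul_mul_single]
  set p := e (E 1) with hp
  have hpp : p * p = p := by rw [hp, ← map_mul, hEmul, one_mul]
  have hp0 : p ≠ 0 := by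
    rw [hp, Ne, map_eq_zero_iff e e.injective]
    intro h
    have : E 1 = E 0 := by simpa [E] using h
    exact one_ne_zero (hEinj this)
  obtain ⟨i, j, hij⟩ : ∃ i j, p i j ≠ 0 := by
    by_contra! h
    exact hp0 (by ext i j; exact h i j)
  -- Since `p` is idempotent, `p * single j i 1 * p` squares to `p i j` times itself.
  set q := (p i j)⁻¹ • (p * single j i 1 * p) with hq
  have hs : ∀ M : Matrix (Fin m) (Fin m) K,
      single j i (1 : K) * M * single j i 1 = M i j • single j i 1 := fun M => by
    rw [single_mul_mul_single]; simp
  have hqM : ∀ M, q * M * q = ((p i j)⁻¹ * (p * M * p) i j) • q := fun M => by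
    have : q * M * q = ((p i j)⁻¹ * (p i j)⁻¹) •
        (p * (single j i 1 * (p * M * p) * single j i 1) * p) := by
      simp only [hq, smul_mul_assoc, mul_smul_comm, smul_smul, mul_assoc]
    rw [this, hs, hq]
    simp only [smul_mul_assoc, mul_smul_comm, smul_smul]
    congr 1
    ring
  have hqq : q * q = q := by
    have := hqM 1
    rwa [mul_one, mul_one, hpp, inv_mul_cancel₀ hij, one_smul] at this
  have hq0 : q ≠ 0 := fun h => by
    have h1 : p * single j i 1 * p = 0 := by
      simpa [hq, hij] using h
    have h2 : single j i 1 * (p * single j i 1 * p) * single j i (1 : K) =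
        (p i j * p i j) • single j i 1 := by
      rw [show single j i 1 * (p * single j i 1 * p) * single j i (1 : K) =
        single j i 1 * p * single j i 1 * p * single j i 1 by simp only [mul_assoc], hs,
        smul_mul_assoc, smul_mul_assoc, hs, smul_smul]
    rw [h1] at h2
    have h3 := congrFun (congrFun h2 j) i
    simp [hij] at h3
  have hpqp : p * q * p = q := by
    simp only [hq, smul_mul_assoc, mul_smul_comm]
    rw [show p * (p * single j i 1 * p) * p = (p * p) * single j i 1 * (p * p) by
      simp only [mul_assoc], hpp]
  set h := e.symm q o o with hh
  have hEh : E h = e.symm q := by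
    rw [hh, ← hE, ← e.symm_apply_apply (E 1), ← hp, ← map_mul, ← map_mul, hpqp]
  have hidem : h * h = h := hEinj (by rw [← hEmul, hEh, ← map_mul, hqq])
  have hh0 : h ≠ 0 := fun h0 => hq0 (by
    have : e.symm q = 0 := by rw [← hEh, h0]; simp [E]
    simpa using this)
  refine isBinaryNorm_of_isIdempotentElem h2 ha hidem hh0 fun h1 => ?_
  -- If `h = 1`, the whole corner is the line spanned by `q`, so the quaternion i would be a scalar.
  have hqp : q = p := by rw [hp, ← h1, hEh, e.apply_symm_apply]
  have key := hqM (e (E ⟨0, 1, 0, 0⟩))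
  rw [hqp, hp, ← map_mul, ← map_mul, hEmul, hEmul, one_mul, mul_one, ← map_smul, ← hEsmul] at key
  have := congrArg QuaternionAlgebra.imI (hEinj (e.injective key))
  simp at this

/-- The matrices representing `i` and `j` when `b = p² - a q²`. -/
def splitBasis (a p q : K) :
    QuaternionAlgebra.Basis (Matrix (Fin 2) (Fin 2) K) a 0 (p ^ 2 - a * q ^ 2) where
  i := !![0, a; 1, 0]
  j := !![p, -a * q; q, -p]
  k := !![a * q, -a * p; p, -a * q]
  i_mul_i := by ext i j; fin_cases i <;> fin_cases j <;> simp
  j_mul_j := by ext i j; fin_cases i <;> fin_cases j <;> simp <;> ring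
  i_mul_j := by ext i j; fin_cases i <;> fin_cases j <;> simp
  j_mul_i := by ext i j; fin_cases i <;> fin_cases j <;> simp <;> ring

/-- In `splitBasis`, i acts on K[X]/(X² - a) as multiplication by X, and j as conjugation followed
by multiplication by p + qX. Simplicity makes this representation injective; dimension 4 makes it
bijective. -/
theorem nonempty_algEquiv_matrix {a b : K} (h2 : (2 : K) ≠ 0) (ha : a ≠ 0) (hb : b ≠ 0)
    (h : IsBinaryNorm a b) : Nonempty (ℍ[K,a,b] ≃ₐ[K] Matrix (Fin 2) (Fin 2) K) := by
  obtain ⟨p, q, rfl⟩ := h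
  have := isSimpleRing a _ h2 ha hb
  let F := (splitBasis a p q).liftHom
  have hinj : Function.Injective F := RingHom.injective F.toRingHom
  have hfin : Module.finrank K ℍ[K,a,p ^ 2 - a * q ^ 2] =
      Module.finrank K (Matrix (Fin 2) (Fin 2) K) := by
    rw [QuaternionAlgebra.finrank_eq_four, Module.finrank_matrix]; simp
  exact ⟨.ofBijective F ⟨hinj,
    (LinearMap.injective_iff_surjective_of_finrank_eq_finrank hfin (f := F.toLinearMap)).mp hinj⟩⟩

end QuaternionSymbol

theorem hilbertSymbolEqZero_iff {K : Type u} [Field K] {a b : K} (h2 : (2 : K) ≠ 0) (ha : a ≠ 0)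
    (hb : b ≠ 0) : HilbertSymbolEqZero K a b ↔ IsBinaryNorm a b := by
  constructor
  · rintro ⟨h2, ha, hb, h⟩
    obtain ⟨n, m, hn, -, ⟨e⟩⟩ := Quotient.exact h
    exact QuaternionSymbol.isBinaryNorm_of_matrix_algEquiv h2 ha hn e
  · intro h
    obtain ⟨e⟩ := QuaternionSymbol.nonempty_algEquiv_matrix h2 ha hb h
    exact ⟨h2, ha, hb, Quotient.sound ⟨1, 1 * 2, one_ne_zero, by norm_num,
      ⟨(e.mapMatrix (m := Fin 1)).trans ((Matrix.compAlgEquiv _ _ _ _).trans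
        (Matrix.reindexAlgEquiv K K finProdFinEquiv))⟩⟩⟩

/-! ### Rationality and transcendence degree -/

section FieldExtensions

variable {k : Type u} {L : Type v} [Field k] [Field L] [Algebra k L]

open scoped IntermediateField.algebraAdjoinAdjoin in
theorem isAlgebraic_algebraAdjoin {S : Set L}
    (h : Algebra.IsAlgebraic (IntermediateField.adjoin k S) L) :
    Algebra.IsAlgebraic (Algebra.adjoin k S) L :=
  (IsFractionRing.comap_isAlgebraic_iff (K := IntermediateField.adjoin k S)).mpr h

theorem isRationalExtension_of_adjoin_pair_eq_top (htr : Algebra.trdeg k L = 2) (u v : L)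
    (h : IntermediateField.adjoin k {u, v} = ⊤) : IsRationalExtension k L := by
  have hr : Set.range ![u, v] = {u, v} := by simp [Set.pair_comm]
  have halg : Algebra.IsAlgebraic (Algebra.adjoin k (Set.range ![u, v])) L := by
    rw [hr]
    refine isAlgebraic_algebraAdjoin ?_
    rw [h]
    exact ⟨fun x => isAlgebraic_algebraMap (⟨x, trivial⟩ : (⊤ : IntermediateField k L))⟩
  have hb : IsTranscendenceBasis k ![u, v] :=
    Algebra.IsAlgebraic.isTranscendenceBasis_of_lift_le_trdeg_of_finite k _ (by simp [htr])
  exact ⟨2, ⟨((hb.1.aevalEquivField.trans (IntermediateField.equivOfEq (by rw [hr, h]))).trans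
    IntermediateField.topEquiv).symm⟩⟩

/-- The algebraic closure of k(w) in L has transcendence degree at most 1. It serves to show that
denominators do not vanish: otherwise it would contain all generators. -/
theorem exists_intermediateField_sq_mem (htr : Algebra.trdeg k L = 2) (w : L) :
    ∃ C : IntermediateField k L, w ∈ C ∧ C ≠ ⊤ ∧ ∀ z, z ^ 2 ∈ C → z ∈ C := by
  let F := IntermediateField.adjoin k {w}
  have hC : ∀ x, x ∈ (algebraicClosure F L).restrictScalars k ↔ IsAlgebraic F x := fun x => by
    rw [IntermediateField.mem_restrictScalars, mem_algebraicClosure_iff]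
  refine ⟨(algebraicClosure F L).restrictScalars k, ?_, ?_, ?_⟩
  · rw [hC]
    exact isAlgebraic_algebraMap (⟨w, IntermediateField.mem_adjoin_simple_self k w⟩ : F)
  · intro h
    have h1 : Algebra.IsAlgebraic F L := ⟨fun x => by rw [← hC, h]; trivial⟩
    have := isAlgebraic_algebraAdjoin h1
    have := Algebra.IsAlgebraic.trdeg_le_cardinalMk k {w}
    rw [htr] at this
    simp at this
  · intro z hz
    rw [hC] at hz ⊢
    exact IsAlgebraic.of_pow two_pos hz

theorem IsRationalExtension.isStablyRationalExtension (h : IsRationalExtension k L) :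
    IsStablyRationalExtension k L := by
  obtain ⟨n, ⟨e⟩⟩ := h
  refine ⟨0, n, ⟨(AlgEquiv.ofBijective
    (IsScalarTower.toAlgHom k L (FractionRing (MvPolynomial (Fin 0) L)))
    ⟨RingHom.injective _, fun x => ?_⟩).symm.trans e⟩⟩
  obtain ⟨p, q, -, rfl⟩ := IsFractionRing.div_surjective (A := MvPolynomial (Fin 0) L) x
  rw [MvPolynomial.eq_C_of_isEmpty p, MvPolynomial.eq_C_of_isEmpty q]
  refine ⟨MvPolynomial.coeff 0 p / MvPolynomial.coeff 0 q, ?_⟩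
  simp [map_div₀, IsScalarTower.algebraMap_apply L (MvPolynomial (Fin 0) L)
    (FractionRing (MvPolynomial (Fin 0) L)), MvPolynomial.algebraMap_eq]

theorem IsStablyRationalExtension.isUnirationalExtension (h : IsStablyRationalExtension k L) :
    IsUnirationalExtension k L := by
  obtain ⟨m, n, ⟨e⟩⟩ := h
  exact ⟨n, ⟨e.toAlgHom.comp
    (IsScalarTower.toAlgHom k L (FractionRing (MvPolynomial (Fin m) L)))⟩⟩

theorem exists_add_mul_eq_of_adjoin_eq_top {s : L} {δ : k} (hs : s ^ 2 = algebraMap k L δ)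
    (h : IntermediateField.adjoin k {s} = ⊤) (x : L) :
    ∃ p q : k, x = algebraMap k L p + algebraMap k L q * s := by
  have hint : IsAlgebraic k s := .of_pow two_pos (hs ▸ isAlgebraic_algebraMap δ)
  have hx : x ∈ Algebra.adjoin k {s} := by
    rw [← IntermediateField.adjoin_simple_toSubalgebra_of_isAlgebraic hint, h]
    trivial
  induction hx using Algebra.adjoin_induction with
  | mem x hx => exact ⟨0, 1, by simpa using hx⟩
  | algebraMap r => exact ⟨r, 0, by simp⟩
  | add x y _ _ hx hy =>
    obtain ⟨p, q, rfl⟩ := hx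
    obtain ⟨p', q', rfl⟩ := hy
    exact ⟨p + p', q + q', by simp only [map_add]; ring⟩
  | mul x y _ _ hx hy =>
    obtain ⟨p, q, rfl⟩ := hx
    obtain ⟨p', q', rfl⟩ := hy
    exact ⟨p * p' + q * q' * δ, p * q' + q * p', by
      simp only [map_add, map_mul, ← hs]; ring⟩

end FieldExtensions

/-! ### Common values of the two binary forms -/

/-- The binary forms `y² - a z²` and `e w² - a f x²` have a common non-zero value. -/
def HasCommonValue {k : Type*} [Field k] (a e f : k) : Prop :=
  ∃ y z w x : k, y ^ 2 - a * z ^ 2 = e * w ^ 2 - a * f * x ^ 2 ∧ y ^ 2 - a * z ^ 2 ≠ 0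

section CommonValue

variable {k : Type u} [Field k] {a e f : k}

/-- Clear denominators and evaluate where the numerator of y is non-zero. The common denominator may
vanish there, which the homogeneous form allows; the value is non-zero because a is not a square. -/
theorem hasCommonValue_of_fractionRing [Infinite k] (ha : ¬ IsSquare a) {n : ℕ}
    {x y z : FractionRing (MvPolynomial (Fin n) k)} (hy : y ≠ 0)
    (h : y ^ 2 - algebraMap k _ a * z ^ 2 = algebraMap k _ e - algebraMap k _ (a * f) * x ^ 2) :
    HasCommonValue a e f := by
  classical
  obtain ⟨⟨b, hb⟩, hint⟩ := IsLocalization.exist_integer_multiples_of_finset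
    (nonZeroDivisors (MvPolynomial (Fin n) k)) {x, y, z}
  obtain ⟨p, hp⟩ := hint x (by simp)
  obtain ⟨q, hq⟩ := hint y (by simp)
  obtain ⟨r, hr⟩ := hint z (by simp)
  simp only [Algebra.smul_def] at hp hq hr
  have hb0 : algebraMap _ (FractionRing (MvPolynomial (Fin n) k)) b ≠ 0 :=
    IsFractionRing.to_map_ne_zero_of_mem_nonZeroDivisors hb
  have hq0 : q ≠ 0 := by
    rintro rfl
    rw [map_zero] at hq
    exact mul_ne_zero hb0 hy hq.symm
  have hpoly : q ^ 2 - .C a * r ^ 2 = .C e * b ^ 2 - .C (a * f) * p ^ 2 := by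
    apply IsFractionRing.injective (MvPolynomial (Fin n) k)
      (FractionRing (MvPolynomial (Fin n) k))
    simp only [map_sub, map_mul, map_pow, hp, hq, hr, ← MvPolynomial.algebraMap_eq,
      ← IsScalarTower.algebraMap_apply] at h ⊢
    linear_combination (algebraMap _ (FractionRing (MvPolynomial (Fin n) k)) b) ^ 2 * h
  obtain ⟨t, ht⟩ : ∃ t, MvPolynomial.eval t q ≠ 0 := by
    by_contra! h0
    exact hq0 (MvPolynomial.funext fun t => by simp [h0])
  have heval := congrArg (MvPolynomial.eval t) hpoly
  simp only [map_sub, map_mul, map_pow, MvPolynomial.eval_C] at heval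
  exact ⟨_, _, _, _, heval, sq_sub_mul_sq_ne_zero ha (.inl ht)⟩

variable {k' : Type w} [Field k'] [Algebra k k'] {s : k'}

theorem HasCommonValue.isBinaryNorm (hs : s ^ 2 = algebraMap k k' (e * f))
    (h : HasCommonValue a e f) : IsBinaryNorm (algebraMap k k' a) (algebraMap k k' f) := by
  obtain ⟨y, z, w, x, h, h0⟩ := h
  have h0' := (map_ne_zero (algebraMap k k')).mpr h0
  have h' := congrArg (algebraMap k k') h
  simp only [map_sub, map_mul, map_pow] at h0' h' hs
  refine .of_mul_eq (r := s * algebraMap k k' w) (s := algebraMap k k' (f * x)) h0' ?_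
  simp only [map_mul]
  linear_combination algebraMap k k' f * h' - algebraMap k k' w ^ 2 * hs

theorem hasCommonValue_of_isBinaryNorm (h2 : (2 : k) ≠ 0) (ha : ¬ IsSquare a) (hf : f ≠ 0)
    (hs : s ^ 2 = algebraMap k k' (e * f)) (hk' : IntermediateField.adjoin k {s} = ⊤)
    (h : IsBinaryNorm (algebraMap k k' a) (algebraMap k k' f)) : HasCommonValue a e f := by
  have ha0 : a ≠ 0 := fun h => ha (by simp [h])
  have hinj := (algebraMap k k').injective
  obtain ⟨p, q, h⟩ := h
  obtain ⟨p₀, p₁, rfl⟩ := exists_add_mul_eq_of_adjoin_eq_top hs hk' p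
  obtain ⟨q₀, q₁, rfl⟩ := exists_add_mul_eq_of_adjoin_eq_top hs hk' q
  by_cases hsk : ∃ σ, s = algebraMap k k' σ
  · obtain ⟨σ, rfl⟩ := hsk
    have h' : f = (p₀ + p₁ * σ) ^ 2 - a * (q₀ + q₁ * σ) ^ 2 := hinj (by simpa using h)
    -- If √(ef) ∈ k, then f is a norm over k, and so is -af, as -a is the norm of √a.
    have key : (a * (q₀ + q₁ * σ)) ^ 2 - a * (p₀ + p₁ * σ) ^ 2 = e * 0 ^ 2 - a * f * 1 ^ 2 := by
      linear_combination a * h'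
    refine ⟨_, _, _, _, key, ?_⟩
    rw [key]
    simp [ha0, hf]
  have hcoef : ∀ m n : k, algebraMap k k' m + algebraMap k k' n * s = 0 → m = 0 ∧ n = 0 := by
    intro m n hmn
    have hn : n = 0 := by
      by_contra hn
      have hn' := (map_ne_zero (algebraMap k k')).mpr hn
      refine hsk ⟨-m / n, ?_⟩
      rw [map_div₀, map_neg]
      field_simp
      linear_combination hmn
    subst hn
    simpa using hmn
  obtain ⟨h₀, h₁⟩ := hcoef (p₀ ^ 2 - a * q₀ ^ 2 + e * f * (p₁ ^ 2 - a * q₁ ^ 2) - f)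
    (2 * (p₀ * p₁ - a * q₀ * q₁)) (by
      simp only [map_sub, map_mul, map_add, map_pow, map_ofNat] at hs ⊢
      linear_combination -h + (algebraMap k k' a * algebraMap k k' q₁ ^ 2 -
        algebraMap k k' p₁ ^ 2) * hs)
  replace h₁ := (mul_eq_zero.mp h₁).resolve_left h2
  by_cases h0 : p₀ ≠ 0 ∨ q₀ ≠ 0
  · have hN := sq_sub_mul_sq_ne_zero ha h0
    -- Multiply `h₀` by afN(p₀, q₀). By `h₁`, N(p₀, q₀)N(p₁, q₁) = -a(q₀p₁ - p₀q₁)², which makes the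
    -- e-term a square times e.
    refine ⟨f * a * q₀, f * p₀, f * a * (q₀ * p₁ - p₀ * q₁), p₀ ^ 2 - a * q₀ ^ 2, ?_, ?_⟩
    · linear_combination a * f * (p₀ ^ 2 - a * q₀ ^ 2) * h₀ -
        e * f ^ 2 * a * (p₀ * p₁ - a * q₀ * q₁) * h₁
    · rw [show (f * a * q₀) ^ 2 - a * (f * p₀) ^ 2 = -a * f ^ 2 * (p₀ ^ 2 - a * q₀ ^ 2) by ring]
      simp [ha0, hf, hN]
  · push Not at h0
    obtain ⟨rfl, rfl⟩ := h0
    have he : e ≠ 0 := by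
      rintro rfl
      exact hsk ⟨0, by simpa using hs⟩
    have hN : e * (p₁ ^ 2 - a * q₁ ^ 2) = 1 := mul_left_cancel₀ hf (by linear_combination h₀)
    have key : (e * p₁) ^ 2 - a * (e * q₁) ^ 2 = e * 1 ^ 2 - a * f * 0 ^ 2 := by
      linear_combination e * hN
    refine ⟨_, _, _, _, key, ?_⟩
    rw [key]
    simpa using he

end CommonValue

/-! ### The function field of the quadric -/

section QuadricFunctionField

variable {k : Type u} {L : Type v} [Field k] [Field L] [Algebra k L]

theorem IntermediateField.eq_top_of_triple_mem {x y z : L}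
    (hgen : IntermediateField.adjoin k {x, y, z} = ⊤) {F : IntermediateField k L}
    (hx : x ∈ F) (hy : y ∈ F) (hz : z ∈ F) : F = ⊤ := by
  rw [eq_top_iff, ← hgen, IntermediateField.adjoin_le_iff]
  rintro t (rfl | rfl | rfl) <;> assumption

theorem mem_of_mul_mem {F : IntermediateField k L} {x c : L} (hc : c ≠ 0) (hcF : c ∈ F)
    (h : x * c ∈ F) : x ∈ F := by
  rw [← mul_div_cancel_right₀ x hc]
  exact F.div_mem h hcF

theorem isRationalExtension_of_hasCommonValue (h2 : (2 : k) ≠ 0)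
    (htr : Algebra.trdeg k L = 2) {a e f : k} (ha0 : a ≠ 0) {x y z : L}
    (hgen : IntermediateField.adjoin k {x, y, z} = ⊤)
    (h : y ^ 2 - algebraMap k L a * z ^ 2 = algebraMap k L e - algebraMap k L (a * f) * x ^ 2)
    (hv : HasCommonValue a e f) : IsRationalExtension k L := by
  obtain ⟨y₀, z₀, w₀, x₀, h0, hne⟩ := hv
  have hcF : ∀ (F : IntermediateField k L) (c : k), algebraMap k L c ∈ F :=
    fun F c => F.algebraMap_mem c
  have h0' := congrArg (algebraMap k L) h0
  have hne' := (map_ne_zero (algebraMap k L)).mpr hne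
  have h2' : (2 : L) ≠ 0 := by
    rw [← map_ofNat (algebraMap k L) 2]
    exact (map_ne_zero (algebraMap k L)).mpr h2
  have ha0' := (map_ne_zero (algebraMap k L)).mpr ha0
  simp only [map_sub, map_mul, map_pow] at h h0' hne'
  have h2F : ∀ F : IntermediateField k L, (2 : L) ∈ F := fun F => by simp
  have aF := fun F => hcF F a
  have eF := fun F => hcF F e
  have fF := fun F => hcF F f
  have y₀F := fun F => hcF F y₀
  have z₀F := fun F => hcF F z₀
  have w₀F := fun F => hcF F w₀
  have x₀F := fun F => hcF F x₀
  have hdeg : w₀ = 0 → x₀ = 0 → False := by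
    rintro rfl rfl
    exact hne (by simpa using h0)
  generalize algebraMap k L a = A at *
  generalize algebraMap k L e = E at *
  generalize algebraMap k L f = B at *
  generalize algebraMap k L y₀ = Y₀ at *
  generalize algebraMap k L z₀ = Z₀ at *
  have hV : x * algebraMap k L w₀ + algebraMap k L x₀ ≠ 0 := by
    intro hV
    by_cases hw : w₀ = 0
    · subst hw
      exact hdeg rfl (by simpa using hV)
    have hw' := (map_ne_zero (algebraMap k L)).mpr hw
    obtain ⟨C, hyC, hC, hsq⟩ := exists_intermediateField_sq_mem htr y
    have hxC : x ∈ C := mem_of_mul_mem hw' (w₀F C) (by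
      rw [eq_neg_of_add_eq_zero_left hV]
      exact C.neg_mem (x₀F C))
    refine hC (IntermediateField.eq_top_of_triple_mem hgen hxC hyC (hsq _ ?_))
    refine mem_of_mul_mem ha0' (aF C) ?_
    rw [show z ^ 2 * A = y ^ 2 - E + A * B * x ^ 2 by linear_combination -h]
    exact C.add_mem (C.sub_mem (pow_mem hyC 2) (eF C))
      (C.mul_mem (C.mul_mem (aF C) (fF C)) (pow_mem hxC 2))
  generalize algebraMap k L w₀ = W₀ at *
  generalize algebraMap k L x₀ = X₀ at *
  -- Brahmagupta composition with the common value: Y + Z√A = (y + z√A)(Y₀ + Z₀√A), and likewise U,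
  -- V for the other form.
  set Y := y * Y₀ + A * z * Z₀ with hY
  set Z := y * Z₀ + z * Y₀ with hZ
  set U := E * W₀ + A * B * x * X₀ with hU
  set V := x * W₀ + X₀ with hVdef
  have hquad : Y ^ 2 - A * Z ^ 2 = U ^ 2 - A * E * B * V ^ 2 := by
    simp only [hY, hZ, hU, hVdef]
    linear_combination (Y₀ ^ 2 - A * Z₀ ^ 2) * h + (E - A * B * x ^ 2) * h0'
  have hall : ∀ F : IntermediateField k L, Y / V ∈ F → Z / V ∈ F → U / V ∈ F → F = ⊤ := by
    intro F hYF hZF hUF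
    -- U/V is a Möbius transform of x whose determinant is, up to sign, the common value; inverting
    -- it recovers x.
    have hden : U / V * W₀ - A * B * X₀ = (Y₀ ^ 2 - A * Z₀ ^ 2) / V := by
      field_simp
      rw [h0', hU, hVdef]
      ring
    have hxF : x ∈ F := by
      refine mem_of_mul_mem (c := U / V * W₀ - A * B * X₀)
        (by rw [hden]; exact div_ne_zero hne' hV) ?_ ?_
      · exact F.sub_mem (F.mul_mem hUF (w₀F F)) (F.mul_mem (F.mul_mem (aF F) (fF F)) (x₀F F))
      · rw [show x * (U / V * W₀ - A * B * X₀) = E * W₀ - U / V * X₀ by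
          field_simp
          rw [hU, hVdef]
          ring]
        exact F.sub_mem (F.mul_mem (eF F) (w₀F F)) (F.mul_mem hUF (x₀F F))
    have hVF : V ∈ F := F.add_mem (F.mul_mem hxF (w₀F F)) (x₀F F)
    have hYF' : Y ∈ F := by simpa [hV] using F.mul_mem hYF hVF
    have hZF' : Z ∈ F := by simpa [hV] using F.mul_mem hZF hVF
    have hgF : Y₀ ^ 2 - A * Z₀ ^ 2 ∈ F :=
      F.sub_mem (pow_mem (y₀F F) 2) (F.mul_mem (aF F) (pow_mem (z₀F F) 2))
    refine IntermediateField.eq_top_of_triple_mem hgen hxF (mem_of_mul_mem hne' hgF ?_)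
      (mem_of_mul_mem hne' hgF ?_)
    · rw [show y * (Y₀ ^ 2 - A * Z₀ ^ 2) = Y * Y₀ - A * Z * Z₀ by rw [hY, hZ]; ring]
      exact F.sub_mem (F.mul_mem hYF' (y₀F F)) (F.mul_mem (F.mul_mem (aF F) hZF') (z₀F F))
    · rw [show z * (Y₀ ^ 2 - A * Z₀ ^ 2) = Z * Y₀ - Y * Z₀ by rw [hY, hZ]; ring]
      exact F.sub_mem (F.mul_mem hZF' (y₀F F)) (F.mul_mem hYF' (z₀F F))
  have hT : Y + U ≠ 0 := by
    intro hT
    obtain ⟨C, hYC, hC, hsq⟩ := exists_intermediateField_sq_mem htr (Y / V)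
    refine hC (hall C hYC (hsq _ ?_) ?_)
    · rw [show (Z / V) ^ 2 = E * B by
        field_simp
        refine mul_left_cancel₀ ha0' ?_
        linear_combination -hquad + (Y - U) * hT]
      exact C.mul_mem (eF C) (fF C)
    · rw [show U / V = -(Y / V) by field_simp; linear_combination hT]
      exact C.neg_mem hYC
  refine isRationalExtension_of_adjoin_pair_eq_top htr ((Y + U) / V) (Z / V) ?_
  set F := IntermediateField.adjoin k {(Y + U) / V, Z / V}
  have hTF : (Y + U) / V ∈ F := IntermediateField.subset_adjoin _ _ (by simp)
  have hZF : Z / V ∈ F := IntermediateField.subset_adjoin _ _ (by simp)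
  have hDF : (Y - U) / V ∈ F := by
    rw [show (Y - U) / V = A * ((Z / V) ^ 2 - E * B) / ((Y + U) / V) by
      field_simp
      linear_combination hquad]
    exact F.div_mem (F.mul_mem (aF F) (F.sub_mem (pow_mem hZF 2) (F.mul_mem (eF F) (fF F)))) hTF
  refine hall F ?_ hZF ?_
  · rw [show Y / V = ((Y + U) / V + (Y - U) / V) / 2 by field_simp; ring]
    exact F.div_mem (F.add_mem hTF hDF) (h2F F)
  · rw [show U / V = ((Y + U) / V - (Y - U) / V) / 2 by field_simp; ring]
    exact F.div_mem (F.sub_mem hTF hDF) (h2F F)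

theorem IsUnirationalExtension.hasCommonValue [Infinite k] (htr : Algebra.trdeg k L = 2)
    {a e f : k} (ha : ¬ IsSquare a) {x y z : L}
    (hgen : IntermediateField.adjoin k {x, y, z} = ⊤)
    (h : y ^ 2 - algebraMap k L a * z ^ 2 = algebraMap k L e - algebraMap k L (a * f) * x ^ 2)
    (hu : IsUnirationalExtension k L) : HasCommonValue a e f := by
  obtain ⟨n, ⟨φ⟩⟩ := hu
  have ha0 : a ≠ 0 := fun h => ha (by simp [h])
  have hy : y ≠ 0 := by
    rintro rfl
    obtain ⟨C, hxC, hC, hsq⟩ := exists_intermediateField_sq_mem htr x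
    refine hC (IntermediateField.eq_top_of_triple_mem hgen hxC C.zero_mem (hsq _ ?_))
    refine mem_of_mul_mem ((map_ne_zero (algebraMap k L)).mpr ha0) (C.algebraMap_mem a) ?_
    rw [show z ^ 2 * algebraMap k L a = algebraMap k L (a * f) * x ^ 2 - algebraMap k L e by
      linear_combination -h]
    exact C.sub_mem (C.mul_mem (C.algebraMap_mem _) (pow_mem hxC 2)) (C.algebraMap_mem _)
  refine hasCommonValue_of_fractionRing ha (x := φ x) (y := φ y) (z := φ z)
    ((map_ne_zero φ).mpr hy) ?_
  simpa only [map_sub, map_mul, map_pow, AlgHom.commutes] using congrArg φ h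

/-- Parametrizing the conic `t₁² - a t₂² = β²` turns the function field of
`t₁² - a t₂² = β²`, `t₃² - a t₄² = 2 c t₁ + d` into that of an affine quadric. -/
theorem exists_quadric_generators (h2 : (2 : k) ≠ 0) {a c d β : k} (ha0 : a ≠ 0) (hβ : β ≠ 0)
    {t₁ t₂ t₃ t₄ : L} (hgen : IntermediateField.adjoin k {t₁, t₂, t₃, t₄} = ⊤)
    (htr : Algebra.trdeg k L = 2)
    (h₁ : t₁ ^ 2 - algebraMap k L a * t₂ ^ 2 = algebraMap k L (β ^ 2))
    (h₂ : t₃ ^ 2 - algebraMap k L a * t₄ ^ 2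
      = 2 * algebraMap k L c * t₁ + algebraMap k L d) :
    ∃ x y z : L, IntermediateField.adjoin k {x, y, z} = ⊤ ∧
      y ^ 2 - algebraMap k L a * z ^ 2 = algebraMap k L (2 * c * β + d) -
        algebraMap k L (a * (-2 * c * β + d)) * x ^ 2 := by
  have h2' : (2 : L) ≠ 0 := by
    rw [← map_ofNat (algebraMap k L) 2]
    exact (map_ne_zero (algebraMap k L)).mpr h2
  have ha0' := (map_ne_zero (algebraMap k L)).mpr ha0
  have hβ' := (map_ne_zero (algebraMap k L)).mpr hβ
  have aF := fun F : IntermediateField k L => F.algebraMap_mem a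
  have βF := fun F : IntermediateField k L => F.algebraMap_mem β
  have cF := fun F : IntermediateField k L => F.algebraMap_mem c
  have dF := fun F : IntermediateField k L => F.algebraMap_mem d
  have h2F : ∀ F : IntermediateField k L, (2 : L) ∈ F := fun F => by simp
  simp only [map_add, map_mul, map_pow, map_neg, map_ofNat] at h₁ ⊢
  have htop : ∀ F : IntermediateField k L, t₁ ∈ F → t₂ ∈ F → t₃ ∈ F → t₄ ∈ F → F = ⊤ := by
    intro F m₁ m₂ m₃ m₄
    rw [eq_top_iff, ← hgen, IntermediateField.adjoin_le_iff]
    rintro t (rfl | rfl | rfl | rfl) <;> assumption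
  generalize algebraMap k L a = A at *
  generalize algebraMap k L β = b at *
  generalize algebraMap k L c = c' at *
  generalize algebraMap k L d = d' at *
  have hden : t₁ + b ≠ 0 := by
    intro h0
    obtain rfl : t₁ = -b := eq_neg_of_add_eq_zero_left h0
    have ht₂ : t₂ = 0 := by
      have : A * t₂ ^ 2 = 0 := by linear_combination -h₁
      simpa [ha0'] using this
    obtain ⟨C, h₃C, hC, hsq⟩ := exists_intermediateField_sq_mem htr t₃
    refine hC (htop C (C.neg_mem (βF C)) (ht₂ ▸ C.zero_mem) h₃C (hsq _ ?_))
    refine mem_of_mul_mem ha0' (aF C) ?_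
    rw [show t₄ ^ 2 * A = t₃ ^ 2 + 2 * c' * b - d' by linear_combination -h₂]
    exact C.sub_mem (C.add_mem (pow_mem h₃C 2) (C.mul_mem (C.mul_mem (h2F C) (cF C)) (βF C)))
      (dF C)
  obtain ⟨x, hx⟩ : ∃ x, x = t₂ / (t₁ + b) := ⟨_, rfl⟩
  have ht₂ : t₂ = x * (t₁ + b) := by rw [hx]; field_simp
  have ht₁ : t₁ * (1 - A * x ^ 2) = b * (1 + A * x ^ 2) := by
    refine mul_right_cancel₀ hden ?_
    rw [ht₂] at h₁
    linear_combination h₁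
  have hD : 1 - A * x ^ 2 ≠ 0 := by
    intro h0
    have : 2 * b = 0 := by linear_combination (t₁ + b) * h0 - ht₁
    simp [h2', hβ'] at this
  refine ⟨x, t₃ + A * x * t₄, t₃ * x + t₄, ?_, ?_⟩
  · set F := IntermediateField.adjoin k {x, t₃ + A * x * t₄, t₃ * x + t₄}
    have hxF : x ∈ F := IntermediateField.subset_adjoin _ _ (by simp)
    have hyF : t₃ + A * x * t₄ ∈ F := IntermediateField.subset_adjoin _ _ (by simp)
    have hzF : t₃ * x + t₄ ∈ F := IntermediateField.subset_adjoin _ _ (by simp)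
    have hAF : A * x ^ 2 ∈ F := F.mul_mem (aF F) (pow_mem hxF 2)
    have hDF : 1 - A * x ^ 2 ∈ F := F.sub_mem F.one_mem hAF
    have h₁F : t₁ ∈ F := mem_of_mul_mem hD hDF (by
      rw [ht₁]
      exact F.mul_mem (βF F) (F.add_mem F.one_mem hAF))
    refine htop F h₁F ?_ (mem_of_mul_mem hD hDF ?_) (mem_of_mul_mem hD hDF ?_)
    · rw [ht₂]
      exact F.mul_mem hxF (F.add_mem h₁F (βF F))
    · rw [show t₃ * (1 - A * x ^ 2) = t₃ + A * x * t₄ - A * x * (t₃ * x + t₄) by ring]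
      exact F.sub_mem hyF (F.mul_mem (F.mul_mem (aF F) hxF) hzF)
    · rw [show t₄ * (1 - A * x ^ 2) = t₃ * x + t₄ - x * (t₃ + A * x * t₄) by ring]
      exact F.sub_mem hzF (F.mul_mem hxF hyF)
  · linear_combination (1 - A * x ^ 2) * h₂ + 2 * c' * ht₁

end QuadricFunctionField

/-! ### The equivalence -/

/-- `L₀ = k(t₁, t₂, t₃, t₄)` has transcendence degree two over `k`, with `t₁² - a t₂² = b` and
`t₃² - a t₄² = 2 c t₁ + d`, where `b = β²`; and `k' = k(√(d² - 4 b c²))`. -/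
theorem theorem1p3
    {k : Type u} [Field k] [Infinite k] (hchar : (2 : k) ≠ 0)
    (a b c d β : k) (ha : ¬ IsSquare a) (hβ : β ≠ 0) (hb : b = β ^ 2) (hcd : c ≠ 0 ∨ d ≠ 0)
    {L₀ : Type v} [Field L₀] [Algebra k L₀] (t₁ t₂ t₃ t₄ : L₀)
    (hgen : IntermediateField.adjoin k {t₁, t₂, t₃, t₄} = ⊤)
    (htrdeg : Algebra.trdeg k L₀ = 2)
    (h₁ : t₁ ^ 2 - algebraMap k L₀ a * t₂ ^ 2 = algebraMap k L₀ b)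
    (h₂ : t₃ ^ 2 - algebraMap k L₀ a * t₄ ^ 2
      = 2 * algebraMap k L₀ c * t₁ + algebraMap k L₀ d)
    {k' : Type w} [Field k'] [Algebra k k'] (s : k')
    (hs : s ^ 2 = algebraMap k k' (d ^ 2 - 4 * b * c ^ 2))
    (hk' : IntermediateField.adjoin k {s} = ⊤) :
    List.TFAE
      [IsRationalExtension k L₀,
       IsStablyRationalExtension k L₀,
       IsUnirationalExtension k L₀,
       (-2 * c * β + d ≠ 0 ∧
          HilbertSymbolEqZero k' (algebraMap k k' a) (algebraMap k k' (-2 * c * β + d))) ∨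
       (-2 * c * β + d = 0 ∧ HilbertSymbolEqZero k a (2 * d))] := by
  have ha0 : a ≠ 0 := fun h => ha (by simp [h])
  subst hb
  obtain ⟨x, y, z, hxyz, h⟩ := exists_quadric_generators hchar ha0 hβ hgen htrdeg h₁ h₂
  set e := 2 * c * β + d with he
  set f := -2 * c * β + d with hf
  rw [show d ^ 2 - 4 * β ^ 2 * c ^ 2 = e * f by rw [he, hf]; ring] at hs
  have hcommon : HasCommonValue a e f ↔
      (f ≠ 0 ∧ HilbertSymbolEqZero k' (algebraMap k k' a) (algebraMap k k' f)) ∨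
       (f = 0 ∧ HilbertSymbolEqZero k a (2 * d)) := by
    by_cases hf0 : f = 0
    · have hed : e = 2 * d := by rw [he]; linear_combination -hf0
      have hd : d ≠ 0 := by
        rintro rfl
        simp [hf, hchar, hβ] at hf0
        simp [hf0] at hcd
      rw [hilbertSymbolEqZero_iff hchar ha0 (mul_ne_zero hchar hd), ← hed]
      simp only [hf0, ne_eq, not_true_eq_false, false_and, true_and, false_or]
      constructor
      · rintro ⟨y₀, z₀, w₀, x₀, h0, hne⟩
        have hw : w₀ ≠ 0 := by
          rintro rfl
          exact hne (by simpa using h0)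
        exact ⟨y₀ / w₀, z₀ / w₀, by field_simp; linear_combination -h0⟩
      · rintro ⟨p, q, hpq⟩
        refine ⟨p, q, 1, 0, by rw [← hpq]; ring, ?_⟩
        rw [← hpq, hed]
        exact mul_ne_zero hchar hd
    · rw [hilbertSymbolEqZero_iff (by
          rw [← map_ofNat (algebraMap k k') 2]
          exact (map_ne_zero (algebraMap k k')).mpr hchar)
        ((map_ne_zero (algebraMap k k')).mpr ha0) ((map_ne_zero (algebraMap k k')).mpr hf0)]
      simp only [hf0, ne_eq, not_false_eq_true, false_and, true_and, or_false]
      exact ⟨fun hv => hv.isBinaryNorm hs, hasCommonValue_of_isBinaryNorm hchar ha hf0 hs hk'⟩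
  rw [← hcommon]
  tfae_have 1 → 2 := fun h => h.isStablyRationalExtension
  tfae_have 2 → 3 := fun h => h.isUnirationalExtension
  tfae_have 3 → 4 := fun hu => hu.hasCommonValue htrdeg ha hxyz h
  tfae_have 4 → 1 := isRationalExtension_of_hasCommonValue hchar htrdeg ha0 hxyz h
  tfae_finish
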